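/- Let $A=S^1\times[0,1]$ with $S^1=\mathbb R/\mathbb Z$, coordinates $(\theta,s)$ and area form $\omega=d\theta\wedge ds$, and let $L=\{0\}\times[0,1]\subset A$. Hamiltonian flows on $A$ are those generated by smooth functions on $A$ (smooth up to the boundary) whose Hamiltonian vector field is tangent to $\partial A$; they may rotate the boundary circles. Let $\mathrm{Ham}(A)$ be the set of time-one maps of such (possibly time-dependent, $t\in[0,1]$) Hamiltonian flows. For $g\in\mathrm{Ham}(A)$ let $\tilde g:\mathbb R\times[0,1]\to\mathbb R\times[0,1]$ be a lift of $g$ to the universal cover, let $\pi_{\mathbb R}:\mathbb R\times[0,1]\to\mathbb R$ be the projection, and put \[ \mathcal M=\{g\in\mathrm{Ham}(A)\;:\;\pi_{\mathbb R}(\tilde g(0,1))-\pi_{\mathbb R}(\tilde g(0,0))>4\} \] (the difference does not depend on the choice of the lift). For a flow $\phi$ on $A$, a loop of fixed points of $\phi^1$ is a periodic, non-stationary trajectory $c$ of $\phi$ whose minimal period $T_c>0$ satisfies $1/T_c\in\mathbb N$. Then $\mathcal M$ has the fixed loop property detectable by $L$ (the $\mathcal F_L$ property): whenever $g\in\mathcal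 M$ is the time-one map of an autonomous (time-independent) Hamiltonian flow $\phi$ on $A$, there is a loop of fixed points $c$ of $\phi^1=g$ with $c\cap L\neq\emptyset$. -/

import Mathlib

open scoped ContDiff

namespace AnnulusFlow

/-- The annulus `S¹ × [0,1]`, with `S¹ = ℝ/ℤ`. -/
abbrev Annulus : Type := UnitAddCircle × unitInterval

/-- The strip `ℝ × [0,1]`, the universal cover of the annulus, as a subset of the plane. -/
def strip : Set (ℝ × ℝ) := Set.univ ×ˢ Set.Icc (0 : ℝ) 1

/-- The universal covering map `(θ, s) ↦ (θ mod 1, s)`. It is only used on the strip; off the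
strip the second coordinate is clamped to `[0,1]`. -/
noncomputable def cover (z : ℝ × ℝ) : Annulus :=
  ((z.1 : UnitAddCircle), Set.projIcc (0 : ℝ) 1 zero_le_one z.2)

/-- The Hamiltonian vector field of `H : A → ℝ` for the area form `ω = dθ ∧ ds`, in the
coordinates `(θ, s)` of the strip: `ω(X, ·) = dH`, that is `X = (∂H/∂s, -∂H/∂θ)`. The derivatives
at the boundary of the strip are one-sided. -/
noncomputable def hamVectorField (H : Annulus → ℝ) (z : ℝ × ℝ) : ℝ × ℝ :=
  (fderivWithin ℝ (H ∘ cover) strip z (0, 1), -fderivWithin ℝ (H ∘ cover) strip z (1, 0))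

/-- `φ t`, `t ∈ J`, is the Hamiltonian isotopy generated by the time-dependent Hamiltonian `H t`,
`t ∈ J`, where `J` is an interval of times that contains `0`. -/
structure IsHamiltonianIsotopy (J : Set ℝ) (H : ℝ → Annulus → ℝ) (φ : ℝ → Annulus → Annulus) :
    Prop where
  /-- `H` is smooth in time and space, up to the boundary. -/
  smooth : ContDiffOn ℝ ∞ (fun q : ℝ × (ℝ × ℝ) => H q.1 (cover q.2)) (J ×ˢ strip)
  /-- The Hamiltonian vector field is tangent to the two boundary circles. -/
  tangent : ∀ t ∈ J, ∀ θ s : ℝ, s = 0 ∨ s = 1 → (hamVectorField (H t) (θ, s)).2 = 0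
  /-- The trajectory of every point is an integral curve (written in the universal cover) of the
  Hamiltonian vector field which starts at that point. -/
  integral : ∀ z ∈ strip, ∃ γ : ℝ → ℝ × ℝ, γ 0 = z ∧ ∀ t ∈ J, γ t ∈ strip ∧
    HasDerivWithinAt γ (hamVectorField (H t) (γ t)) J t ∧ φ t (cover z) = cover (γ t)

/-- `Ham(A)`: time-one maps of isotopies generated by time-dependent Hamiltonians `H t`,
`t ∈ [0,1]`, whose flow is tangent to the boundary. -/
def Ham : Set (Annulus → Annulus) :=
  {g | ∃ H φ, IsHamiltonianIsotopy (Set.Icc 0 1) H φ ∧ φ 1 = g}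

/-- `φ` is the flow of an autonomous (time-independent) Hamiltonian. -/
def IsAutonomousHamiltonianFlow (φ : Flow ℝ Annulus) : Prop :=
  ∃ H : Annulus → ℝ, IsHamiltonianIsotopy Set.univ (fun _ => H) (fun t x => φ t x)

/-- `T` is the (minimal) period of the point `x`. A stationary point has no period in this
sense. -/
def HasPeriod (φ : Flow ℝ Annulus) (x : Annulus) (T : ℝ) : Prop :=
  IsLeast {t : ℝ | 0 < t ∧ φ t x = x} T

/-- `c` is a loop of fixed points of `φ 1`: a periodic trajectory of `φ` whose rotation number
`1 / T` is a natural number, where `T` is its period. -/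
def IsLoopOfFixedPoints (φ : Flow ℝ Annulus) (c : Set Annulus) : Prop :=
  ∃ x T, c = φ.orbit x ∧ HasPeriod φ x T ∧ ∃ n : ℕ, 1 / T = n

/-- The fixed loop property detectable by `L`: whenever `g ∈ M` is the time-one map of an
autonomous Hamiltonian flow `φ`, it has a loop of fixed points (for `φ`, whichever autonomous
flow generating `g` is chosen) that intersects `L`. -/
def FixedLoopProperty (L : Set Annulus) (M : Set (Annulus → Annulus)) : Prop :=
  ∀ g ∈ M, ∀ φ : Flow ℝ Annulus, IsAutonomousHamiltonianFlow φ → (∀ x, φ 1 x = g x) →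
    ∃ c, IsLoopOfFixedPoints φ c ∧ (c ∩ L).Nonempty

/-- `G` is a lift of `g` to the universal cover. -/
structure IsLift (G : ℝ × ℝ → ℝ × ℝ) (g : Annulus → Annulus) : Prop where
  continuousOn : ContinuousOn G strip
  mapsTo : Set.MapsTo G strip strip
  cover_comp : ∀ z ∈ strip, cover (G z) = g (cover z)

/-- The arc `L = {0} × [0,1]`. -/
def arcL : Set Annulus := {(0 : UnitAddCircle)} ×ˢ Set.univ

/-- The maps `g ∈ Ham(A)` whose lift moves `(0,1)` by more than `4` further in the `ℝ`-direction
than `(0,0)`. The difference does not depend on the lift. -/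
def twistFamily : Set (Annulus → Annulus) :=
  {g | g ∈ Ham ∧ ∃ G, IsLift G g ∧ (G (0, 1)).1 - (G (0, 0)).1 > 4}

end AnnulusFlow

namespace AnnulusFlow

open Set Filter Topology

/-! Lift the flow to `Φ` on the strip and give each point `(0, s)` of the arc a rotation number `ρ
s`: it is `1 / T` if `Φ T (0, s) = (1, s)`, with `T` possibly negative, and `0` if no such `T`
exists. Such a `T` is unique, because a trajectory that advances by a full turn never closes up in
the strip.

The core is that `ρ` is continuous on `[0,1]` (`continuousOn_rotationNumber`). Where `ρ` is `1 / T`,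
the vector field is nonzero and energy conservation makes nearby level sets of `H` pieces of
trajectories, so neighbouring trajectories also close up after one turn, in nearly the same time.
Where no `T` exists, compactness forces the times of neighbouring points to infinity.

On a boundary circle the time-one displacement is within `1` of `ρ`
(`abs_apply_sub_rotationNumber_le`). A twist greater than `4` thus gives `ρ 1 - ρ 0 > 2`, so `[ρ 0,
ρ 1]` contains a nonzero integer. By the intermediate value theorem `ρ` attains it, and the
trajectory where it does is the required loop (`exists_isLoopOfFixedPoints`). -/

/-! ### Covering the annulus by the strip, and lifted flows -/

theorem continuous_cover : Continuous cover :=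
  (AddCircle.continuous_mk' (1 : ℝ)).comp continuous_fst |>.prodMk
    (continuous_projIcc.comp continuous_snd)

theorem mem_strip_iff {z : ℝ × ℝ} : z ∈ strip ↔ z.2 ∈ Icc (0 : ℝ) 1 := by
  simp [strip]

theorem convex_strip : Convex ℝ strip := convex_univ.prod (convex_Icc 0 1)

theorem uniqueDiffOn_strip : UniqueDiffOn ℝ strip :=
  uniqueDiffOn_univ.prod (uniqueDiffOn_Icc zero_lt_one)

theorem add_translation_mem_strip {z : ℝ × ℝ} (hz : z ∈ strip) (a : ℝ) : z + (a, 0) ∈ strip := by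
  simpa [mem_strip_iff] using hz

theorem cover_add_intCast (z : ℝ × ℝ) (n : ℤ) : cover (z + ((n : ℝ), 0)) = cover z := by
  have h : ((z.1 + n : ℝ) : UnitAddCircle) = (z.1 : UnitAddCircle) := by
    rw [AddCircle.coe_add, (AddCircle.coe_eq_zero_iff 1 (x := (n : ℝ))).2 ⟨n, by simp⟩, add_zero]
  simp [cover, h]

theorem snd_eq_of_cover_eq {z w : ℝ × ℝ} (hz : z ∈ strip) (hw : w ∈ strip)
    (h : cover z = cover w) : z.2 = w.2 := by
  have h2 := congrArg (fun x : Annulus => (x.2 : ℝ)) h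
  simpa [cover, projIcc_of_mem _ (mem_strip_iff.1 hz), projIcc_of_mem _ (mem_strip_iff.1 hw)] using h2

/-- Two lifts to the strip of a map on a connected space agree as soon as they agree at a point. -/
theorem lift_unique {X : Type*} [TopologicalSpace X] [PreconnectedSpace X] {f g : X → ℝ × ℝ}
    (hf : Continuous f) (hg : Continuous g) (hfs : ∀ x, f x ∈ strip) (hgs : ∀ x, g x ∈ strip)
    (h : ∀ x, cover (f x) = cover (g x)) (a : X) (ha : (f a).1 = (g a).1) : f = g := by
  have h1 : (fun x => (f x).1) = fun x => (g x).1 :=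
    (AddCircle.isCoveringMap_coe (1 : ℝ)).eq_of_comp_eq (continuous_fst.comp hf)
      (continuous_fst.comp hg) (funext fun x => congrArg Prod.fst (h x)) a ha
  funext x
  exact Prod.ext (congrFun h1 x) (snd_eq_of_cover_eq (hfs x) (hgs x) (h x))

/-- `Φ` is the lift to the strip of the flow `φ`. -/
structure IsLiftedFlow (φ : Flow ℝ Annulus) (Φ : ℝ → ℝ × ℝ → ℝ × ℝ) : Prop where
  continuous : Continuous fun q : ℝ × (ℝ × ℝ) => Φ q.1 q.2
  mem_strip : ∀ t z, Φ t z ∈ strip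
  cover_apply : ∀ t z, cover (Φ t z) = φ t (cover z)
  zero_apply : ∀ z ∈ strip, Φ 0 z = z

/-- Only the angle needs lifting, and `ℝ × ℝ²` is simply connected; the height is read off directly.
`Φ 0` is the identity only on the strip, since `cover` clamps heights outside it. -/
theorem exists_isLiftedFlow (φ : Flow ℝ Annulus) : ∃ Φ, IsLiftedFlow φ Φ := by
  have hc : Continuous fun q : ℝ × (ℝ × ℝ) => φ q.1 (cover q.2) :=
    φ.continuous continuous_fst (continuous_cover.comp continuous_snd)
  obtain ⟨W, ⟨hW0, hW⟩, -⟩ :=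
    (AddCircle.isCoveringMap_coe (1 : ℝ)).existsUnique_continuousMap_lifts
      (⟨fun q : ℝ × (ℝ × ℝ) => (φ q.1 (cover q.2)).1, continuous_fst.comp hc⟩ :
        C(ℝ × (ℝ × ℝ), AddCircle (1 : ℝ))) (0, (0, 0)) 0 (by simp [cover])
  have hmem : ∀ q : ℝ × (ℝ × ℝ), (W q, ((φ q.1 (cover q.2)).2 : ℝ)) ∈ strip := fun q =>
    mem_strip_iff.2 (φ q.1 (cover q.2)).2.2
  have hcover : ∀ q : ℝ × (ℝ × ℝ), cover (W q, ((φ q.1 (cover q.2)).2 : ℝ)) =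
      φ q.1 (cover q.2) := fun q =>
    Prod.ext (congrFun hW q) (projIcc_val zero_le_one _)
  have hcont : Continuous fun q : ℝ × (ℝ × ℝ) => (W q, ((φ q.1 (cover q.2)).2 : ℝ)) :=
    W.continuous.prodMk (continuous_subtype_val.comp (continuous_snd.comp hc))
  refine ⟨fun t z => (W (t, z), ((φ t (cover z)).2 : ℝ)), hcont, fun t z => hmem (t, z),
    fun t z => hcover (t, z), fun z hz => ?_⟩
  have : PreconnectedSpace strip := isPreconnected_iff_preconnectedSpace.1
    convex_strip.isPreconnected
  have key := lift_unique (X := strip)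
    (f := fun z => (W (0, z.1), ((φ 0 (cover z.1)).2 : ℝ))) (g := fun z => z.1)
    (hcont.comp (continuous_const.prodMk continuous_subtype_val)) continuous_subtype_val
    (fun z => hmem (0, z.1)) (fun z => z.2) (fun z => by rw [hcover (0, z.1)]; simp)
    ⟨(0, 0), by simp [mem_strip_iff]⟩ hW0
  exact congrFun key ⟨z, hz⟩

namespace IsLiftedFlow

variable {φ : Flow ℝ Annulus} {Φ : ℝ → ℝ × ℝ → ℝ × ℝ}

theorem continuous_time (hΦ : IsLiftedFlow φ Φ) (z : ℝ × ℝ) : Continuous fun t => Φ t z :=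
  hΦ.continuous.comp (continuous_id.prodMk continuous_const)

theorem continuous_space (hΦ : IsLiftedFlow φ Φ) (t : ℝ) : Continuous (Φ t) :=
  hΦ.continuous.comp (continuous_const.prodMk continuous_id)

theorem eq_of_cover_eq (hΦ : IsLiftedFlow φ Φ) {z : ℝ × ℝ} (hz : z ∈ strip) {γ : ℝ → ℝ × ℝ}
    (hγ : Continuous γ) (hγs : ∀ t, γ t ∈ strip) (h : ∀ t, cover (γ t) = φ t (cover z))
    (h0 : γ 0 = z) : γ = fun t => Φ t z :=
  lift_unique hγ (hΦ.continuous_time z) hγs (fun t => hΦ.mem_strip t z)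
    (fun t => by rw [h, hΦ.cover_apply]) 0 (by rw [h0, hΦ.zero_apply z hz])

theorem add_apply (hΦ : IsLiftedFlow φ Φ) (t u : ℝ) (z : ℝ × ℝ) :
    Φ (t + u) z = Φ t (Φ u z) := by
  have h := hΦ.eq_of_cover_eq (hΦ.mem_strip u z) (γ := fun t => Φ (t + u) z)
    ((hΦ.continuous_time z).comp (continuous_add_const u)) (fun t => hΦ.mem_strip _ _)
    (fun t => by rw [hΦ.cover_apply, hΦ.cover_apply, φ.map_add]) (by simp)
  exact congrFun h t

/-- Uniqueness of lifts makes the lifted flow commute with deck translations. -/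
theorem apply_add_intCast (hΦ : IsLiftedFlow φ Φ) (t : ℝ) {z : ℝ × ℝ} (hz : z ∈ strip) (n : ℤ) :
    Φ t (z + ((n : ℝ), 0)) = Φ t z + ((n : ℝ), 0) := by
  have h := hΦ.eq_of_cover_eq (add_translation_mem_strip hz n) (γ := fun t => Φ t z + ((n : ℝ), 0))
    ((hΦ.continuous_time z).add continuous_const)
    (fun t => add_translation_mem_strip (hΦ.mem_strip t z) n)
    (fun t => by rw [cover_add_intCast, cover_add_intCast, hΦ.cover_apply])
    (by rw [hΦ.zero_apply z hz])
  exact (congrFun h t).symm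

theorem apply_intCast_mul (hΦ : IsLiftedFlow φ Φ) {z : ℝ × ℝ} (hz : z ∈ strip) {T : ℝ} {m : ℤ}
    (h : Φ T z = z + ((m : ℝ), 0)) (k : ℤ) : Φ (k * T) z = z + (((k * m : ℤ) : ℝ), 0) := by
  have hneg : Φ (-T) z = z + (((-m : ℤ) : ℝ), 0) := by
    have h1 : Φ (-T) (Φ T z) = z := by
      rw [← hΦ.add_apply, neg_add_cancel, hΦ.zero_apply z hz]
    rw [h, hΦ.apply_add_intCast _ hz] at h1
    rw [eq_sub_of_add_eq h1, sub_eq_add_neg]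
    simp
  induction k using Int.induction_on with
  | zero => simp [hΦ.zero_apply z hz]
  | succ n ih =>
    have e : (((n : ℤ) + 1 : ℤ) : ℝ) * T = (n : ℤ) * T + T := by push_cast; ring
    rw [e, hΦ.add_apply, h, hΦ.apply_add_intCast _ hz, ih]
    refine Prod.ext ?_ (by simp)
    simp only [Prod.fst_add]
    push_cast
    ring
  | pred n ih =>
    have e : ((-(n : ℤ) - 1 : ℤ) : ℝ) * T = ((-(n : ℤ) : ℤ) : ℝ) * T + -T := by push_cast; ring
    rw [e, hΦ.add_apply, hneg, hΦ.apply_add_intCast _ hz, ih]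
    refine Prod.ext ?_ (by simp)
    simp only [Prod.fst_add]
    push_cast
    ring

/-- A trajectory that winds once around the annulus is not closed in the strip. -/
theorem eq_zero_of_apply_eq_self (hΦ : IsLiftedFlow φ Φ) {z : ℝ × ℝ} (hz : z ∈ strip) {T P : ℝ}
    (hT : Φ T z = z + (1, 0)) (hP : Φ P z = z) : P = 0 := by
  by_contra hP0
  -- A closed trajectory has bounded first coordinate, whereas at the times `k * T` it equals `z.1 +
  -- k`.
  have hper : Function.Periodic (fun t => (Φ t z).1) P := fun t => by
    simp only [hΦ.add_apply, hP]
  obtain ⟨C, hC⟩ := (hper.isBounded_of_continuous hP0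
    (continuous_fst.comp (hΦ.continuous_time z))).bddAbove
  obtain ⟨k, hk⟩ := exists_int_gt (C - z.1)
  have h1 := hΦ.apply_intCast_mul hz (m := 1) (by simpa using hT) k
  have h2 : (Φ (k * T) z).1 ≤ C := hC ⟨_, rfl⟩
  rw [h1] at h2
  simp at h2
  linarith

theorem eq_of_apply_eq (hΦ : IsLiftedFlow φ Φ) {z : ℝ × ℝ} (hz : z ∈ strip) {T t u : ℝ}
    (hT : Φ T z = z + (1, 0)) (h : Φ t z = Φ u z) : t = u := by
  refine (sub_eq_zero.1 (hΦ.eq_zero_of_apply_eq_self hz hT (P := u - t) ?_)).symm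
  rw [sub_eq_neg_add, hΦ.add_apply, ← h, ← hΦ.add_apply, neg_add_cancel, hΦ.zero_apply z hz]

end IsLiftedFlow

/-! ### Grönwall uniqueness and the dynamics of the Hamiltonian field -/

/-- A function on the line that vanishes at `0` and satisfies `‖f'‖ ≤ K ‖f‖` locally is zero. -/
theorem eq_zero_of_norm_deriv_le {E : Type*} [NormedAddCommGroup E] [NormedSpace ℝ E]
    {f f' : ℝ → E} (hf : ∀ t, HasDerivAt f (f' t) t) (h0 : f 0 = 0)
    (hb : ∀ R, ∃ K : ℝ, ∀ t ∈ Icc (-R) R, ‖f' t‖ ≤ K * ‖f t‖) (t : ℝ) : f t = 0 := by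
  obtain ⟨K, hK⟩ := hb |t|
  rcases le_total 0 t with ht | ht
  · rw [abs_of_nonneg ht] at hK
    exact eq_zero_of_abs_deriv_le_mul_abs_self_of_eq_zero_right (a := 0) (b := t)
      (fun x _ => (hf x).continuousAt.continuousWithinAt) (fun x _ => (hf x).hasDerivWithinAt) h0
      (fun x hx => hK x ⟨by linarith [hx.1], hx.2.le⟩) t ⟨ht, le_rfl⟩
  · rw [abs_of_nonpos ht] at hK
    have hg : ∀ x, HasDerivAt (fun x => f (-x)) (-f' (-x)) x := fun x => by
      simpa [Function.comp_def] using (hf (-x)).scomp x (hasDerivAt_neg x)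
    have := eq_zero_of_abs_deriv_le_mul_abs_self_of_eq_zero_right (a := 0) (b := -t)
      (f := fun x => f (-x)) (f' := fun x => -f' (-x)) (K := K)
      (fun x _ => (hg x).continuousAt.continuousWithinAt) (fun x _ => (hg x).hasDerivWithinAt)
      (by simpa using h0)
      (fun x hx => by
        rw [norm_neg]
        exact hK (-x) ⟨by linarith [hx.2], by linarith [hx.1]⟩) (-t) ⟨by linarith, le_rfl⟩
    simpa using this

section Hamiltonian

variable {H : Annulus → ℝ} {φ : Flow ℝ Annulus} {Φ : ℝ → ℝ × ℝ → ℝ × ℝ}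

theorem IsHamiltonianIsotopy.contDiffOn
    (hH : IsHamiltonianIsotopy univ (fun _ => H) (fun t x => φ t x)) :
    ContDiffOn ℝ ∞ (H ∘ cover) strip :=
  hH.smooth.comp (f := fun z : ℝ × ℝ => ((0 : ℝ), z)) (by fun_prop) fun z hz => ⟨mem_univ _, hz⟩

theorem IsHamiltonianIsotopy.hasFDerivWithinAt
    (hH : IsHamiltonianIsotopy univ (fun _ => H) (fun t x => φ t x)) {z : ℝ × ℝ} (hz : z ∈ strip) :
    HasFDerivWithinAt (H ∘ cover) (fderivWithin ℝ (H ∘ cover) strip z) strip z :=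
  (hH.contDiffOn.differentiableOn (by simp) z hz).hasFDerivWithinAt

theorem IsHamiltonianIsotopy.contDiffOn_fderivWithin
    (hH : IsHamiltonianIsotopy univ (fun _ => H) (fun t x => φ t x)) :
    ContDiffOn ℝ 1 (fderivWithin ℝ (H ∘ cover) strip) strip :=
  hH.contDiffOn.fderivWithin uniqueDiffOn_strip (by norm_cast)

theorem IsHamiltonianIsotopy.locallyLipschitzOn_hamVectorField
    (hH : IsHamiltonianIsotopy univ (fun _ => H) (fun t x => φ t x)) :
    LocallyLipschitzOn strip (hamVectorField H) :=
  ContDiffOn.locallyLipschitzOn convex_strip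
    ((hH.contDiffOn_fderivWithin.clm_apply contDiffOn_const).prodMk
      (hH.contDiffOn_fderivWithin.clm_apply contDiffOn_const).neg)

namespace IsLiftedFlow

theorem hasDerivAt (hΦ : IsLiftedFlow φ Φ)
    (hH : IsHamiltonianIsotopy univ (fun _ => H) (fun t x => φ t x)) {z : ℝ × ℝ} (hz : z ∈ strip)
    (t : ℝ) : HasDerivAt (fun t => Φ t z) (hamVectorField H (Φ t z)) t := by
  obtain ⟨γ, hγ0, hγ⟩ := hH.integral z hz
  have hd : ∀ t, HasDerivAt γ (hamVectorField H (γ t)) t := fun t =>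
    (hγ t (mem_univ t)).2.1.hasDerivAt univ_mem
  have h := hΦ.eq_of_cover_eq hz (γ := γ)
    (continuous_iff_continuousAt.2 fun t => (hd t).continuousAt)
    (fun t => (hγ t (mem_univ t)).1) (fun t => (hγ t (mem_univ t)).2.2.symm) hγ0
  have := hd t
  rwa [h] at this

/-- Conservation of energy: `dH(X) = ω(X, X) = 0`. -/
theorem hamiltonian_apply (hΦ : IsLiftedFlow φ Φ)
    (hH : IsHamiltonianIsotopy univ (fun _ => H) (fun t x => φ t x)) {z : ℝ × ℝ} (hz : z ∈ strip)
    (t : ℝ) : H (cover (Φ t z)) = H (cover z) := by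
  have hd : ∀ t, HasDerivAt (fun t => (H ∘ cover) (Φ t z)) 0 t := fun t => by
    have h1 := (hH.hasFDerivWithinAt (hΦ.mem_strip t z)).comp_hasDerivAt t (hΦ.hasDerivAt hH hz t)
      (Eventually.of_forall fun t => hΦ.mem_strip t z)
    convert! h1 using 1
    set D := fderivWithin ℝ (H ∘ cover) strip (Φ t z)
    have e : hamVectorField H (Φ t z) = D (0, 1) • ((1 : ℝ), (0 : ℝ)) +
        (-D (1, 0)) • ((0 : ℝ), (1 : ℝ)) := by
      simp [hamVectorField, D]
    rw [e, map_add, map_smul, map_smul, smul_eq_mul, smul_eq_mul]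
    ring
  have := is_const_of_deriv_eq_zero (fun t => (hd t).differentiableAt) (fun t => (hd t).deriv) t 0
  simpa [hΦ.zero_apply z hz] using this

/-- On a bounded time interval, the velocity of a trajectory differs from the vector field at a
point of the same part of the strip by at most a multiple of the distance. -/
theorem exists_norm_sub_le (hΦ : IsLiftedFlow φ Φ)
    (hH : IsHamiltonianIsotopy univ (fun _ => H) (fun t x => φ t x)) (z : ℝ × ℝ) (R : ℝ) :
    ∃ K : ℝ, ∀ t ∈ Icc (-R) R, ∀ u ∈ Icc (-R) R, ∀ s ∈ Icc (0 : ℝ) 1,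
      ‖hamVectorField H (Φ t z) - hamVectorField H ((Φ u z).1, s)‖ ≤
        K * ‖Φ t z - ((Φ u z).1, s)‖ := by
  have hcpt : IsCompact (((fun t => (Φ t z).1) '' Icc (-R) R) ×ˢ Icc (0 : ℝ) 1) :=
    (isCompact_Icc.image (continuous_fst.comp (hΦ.continuous_time z))).prod isCompact_Icc
  obtain ⟨K, hK⟩ := (hH.locallyLipschitzOn_hamVectorField.mono
    (prod_mono (subset_univ _) subset_rfl)).exists_lipschitzOnWith_of_compact hcpt
  exact ⟨K, fun t ht u hu s hs => hK.norm_sub_le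
    ⟨mem_image_of_mem _ ht, mem_strip_iff.1 (hΦ.mem_strip t z)⟩ ⟨mem_image_of_mem _ hu, hs⟩⟩

/-- Zeros of the vector field are stationary. -/
theorem apply_eq_self (hΦ : IsLiftedFlow φ Φ)
    (hH : IsHamiltonianIsotopy univ (fun _ => H) (fun t x => φ t x)) {z : ℝ × ℝ} (hz : z ∈ strip)
    (h0 : hamVectorField H z = 0) (t : ℝ) : Φ t z = z := by
  refine sub_eq_zero.1 (eq_zero_of_norm_deriv_le (f := fun t => Φ t z - z)
    (fun t => (hΦ.hasDerivAt hH hz t).sub_const z) (by simp [hΦ.zero_apply z hz]) (fun R => ?_) t)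
  obtain ⟨K, hK⟩ := hΦ.exists_norm_sub_le hH z R
  refine ⟨K, fun t ht => ?_⟩
  have := hK t ht 0 ⟨by linarith [ht.1, ht.2], by linarith [ht.1, ht.2]⟩ z.2 (mem_strip_iff.1 hz)
  simpa [hΦ.zero_apply z hz, h0] using this

/-- The boundary circles are invariant. -/
theorem apply_snd_of_boundary (hΦ : IsLiftedFlow φ Φ)
    (hH : IsHamiltonianIsotopy univ (fun _ => H) (fun t x => φ t x)) {s : ℝ} (hs : s = 0 ∨ s = 1)
    (θ t : ℝ) : (Φ t (θ, s)).2 = s := by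
  have hsI : s ∈ Icc (0 : ℝ) 1 := by rcases hs with rfl | rfl <;> simp
  have hz : (θ, s) ∈ strip := mem_strip_iff.2 hsI
  refine sub_eq_zero.1 (eq_zero_of_norm_deriv_le (f := fun t => (Φ t (θ, s)).2 - s)
    (fun t => ((hasFDerivAt_snd.comp_hasDerivAt t (hΦ.hasDerivAt hH hz t)).sub_const s))
    (by simp [hΦ.zero_apply _ hz]) (fun R => ?_) t)
  obtain ⟨K, hK⟩ := hΦ.exists_norm_sub_le hH (θ, s) R
  refine ⟨K, fun t ht => ?_⟩
  -- Compare with the horizontal projection to the boundary circle: the field there has zero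
  -- vertical component, so the height error is controlled by itself.
  have h1 := hK t ht t ht s hsI
  have h2 := (norm_snd_le _).trans h1
  have h3 : Φ t (θ, s) - ((Φ t (θ, s)).1, s) = (0, (Φ t (θ, s)).2 - s) := by
    ext <;> simp
  rw [h3, Prod.snd_sub, hH.tangent t (mem_univ t) _ s hs] at h2
  simpa [Prod.norm_def] using h2

end IsLiftedFlow

end Hamiltonian

/-! ### Level sets of the Hamiltonian are locally trajectories -/

namespace IsLiftedFlow

variable {H : Annulus → ℝ} {φ : Flow ℝ Annulus} {Φ : ℝ → ℝ × ℝ → ℝ × ℝ}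

/-- The coordinate `l` increases along trajectories near `p`, so some short time `τ` brings `q.1` to
the `l`-value of `q.2`. The remaining difference is a multiple of `v`; since `dH(v) = l(X) > 0` near
`p`, equal energies force it to vanish. Convexity of the strip lets this work at boundary points
too. -/
theorem eventually_exists_apply_eq_of_pos (hΦ : IsLiftedFlow φ Φ)
    (hH : IsHamiltonianIsotopy univ (fun _ => H) (fun t x => φ t x)) {p : ℝ × ℝ} (hp : p ∈ strip)
    (l : ℝ × ℝ →L[ℝ] ℝ) (v : ℝ × ℝ) (hker : ∀ u, l u = 0 → ∃ c : ℝ, u = c • v)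
    (hl : ∀ z, l (hamVectorField H z) = fderivWithin ℝ (H ∘ cover) strip z v)
    (hpos : 0 < l (hamVectorField H p)) {ε : ℝ} (hε : 0 < ε) :
    ∀ᶠ q in 𝓝 (p, p), q.1 ∈ strip → q.2 ∈ strip → H (cover q.1) = H (cover q.2) →
      ∃ τ, |τ| < ε ∧ Φ τ q.1 = q.2 := by
  have hcont : ContinuousWithinAt (fun z => l (hamVectorField H z)) strip p :=
    l.continuous.continuousAt.comp_continuousWithinAt
      (hH.locallyLipschitzOn_hamVectorField.continuousOn p hp)
  obtain ⟨r, hr, hball⟩ := Metric.mem_nhdsWithin_iff.1 (hcont.eventually (lt_mem_nhds hpos))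
  have hflow : ∀ᶠ q in 𝓝 ((0 : ℝ), p), Φ q.1 q.2 ∈ Metric.ball p r := by
    apply hΦ.continuous.continuousAt.eventually_mem
    simpa [hΦ.zero_apply p hp] using Metric.ball_mem_nhds p hr
  rw [nhds_prod_eq] at hflow
  obtain ⟨P, hP, Q, hQ, hPQ⟩ := eventually_prod_iff.1 hflow
  obtain ⟨d, hd, hdP⟩ := Metric.eventually_nhds_iff_ball.1 hP
  obtain ⟨δ, hδ, hδd, hδε⟩ : ∃ δ > 0, δ < d ∧ δ < ε :=
    ⟨min d ε / 2, by positivity, by linarith [min_le_left d ε, lt_min hd hε],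
      by linarith [min_le_right d ε, lt_min hd hε]⟩
  have hmem : ∀ t ∈ Icc (-δ) δ, ∀ w, Q w → Φ t w ∈ Metric.ball p r := fun t ht w hw =>
    hPQ (hdP t (by rw [mem_ball_zero_iff, Real.norm_eq_abs, abs_lt]
                   exact ⟨by linarith [ht.1], by linarith [ht.2]⟩)) hw
  have hmono : StrictMonoOn (fun t => l (Φ t p)) (Icc (-δ) δ) := by
    refine strictMonoOn_of_deriv_pos (convex_Icc _ _)
      (l.continuous.comp (hΦ.continuous_time p)).continuousOn fun t ht => ?_
    have hder : HasDerivAt (fun t => l (Φ t p)) (l (hamVectorField H (Φ t p))) t :=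
      l.hasFDerivAt.comp_hasDerivAt t (hΦ.hasDerivAt hH hp t)
    rw [hder.deriv]
    exact hball ⟨hmem t (interior_subset ht) p hQ.self_of_nhds, hΦ.mem_strip t p⟩
  have h0 : l (Φ 0 p) = l p := by rw [hΦ.zero_apply p hp]
  have hlow : l (Φ (-δ) p) < l p := h0 ▸
    hmono ⟨le_rfl, by linarith⟩ ⟨by linarith, hδ.le⟩ (neg_lt_zero.2 hδ)
  have hupp : l p < l (Φ δ p) := h0 ▸
    hmono ⟨by linarith, hδ.le⟩ ⟨by linarith, le_rfl⟩ hδ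
  have e1 : ∀ᶠ q in 𝓝 (p, p), l (Φ (-δ) q.1) < l q.2 :=
    ContinuousAt.eventually_lt
      (l.continuous.comp ((hΦ.continuous_space _).comp continuous_fst)).continuousAt
      (l.continuous.comp continuous_snd).continuousAt hlow
  have e2 : ∀ᶠ q in 𝓝 (p, p), l q.2 < l (Φ δ q.1) :=
    ContinuousAt.eventually_lt (l.continuous.comp continuous_snd).continuousAt
      (l.continuous.comp ((hΦ.continuous_space _).comp continuous_fst)).continuousAt hupp
  have e3 : ∀ᶠ q in 𝓝 (p, p), Q q.1 := continuous_fst.continuousAt.eventually hQ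
  have e4 : ∀ᶠ q in 𝓝 (p, p), q.2 ∈ Metric.ball p r :=
    continuous_snd.continuousAt.eventually_mem (Metric.ball_mem_nhds p hr)
  filter_upwards [e1, e2, e3, e4] with ⟨w, w'⟩ h1 h2 h3 h4 hw hw' hHw
  obtain ⟨τ, hτ, hτw⟩ := intermediate_value_Icc (f := fun t => l (Φ t w)) (by linarith : -δ ≤ δ)
    (l.continuous.comp (hΦ.continuous_time w)).continuousOn ⟨h1.le, h2.le⟩
  refine ⟨τ, (abs_le.2 hτ).trans_lt hδε, ?_⟩
  obtain ⟨c, hc⟩ := hker (w' - Φ τ w) (by rw [map_sub]; exact sub_eq_zero.2 hτw.symm)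
  have hconv : Convex ℝ (Metric.ball p r ∩ strip) := (convex_ball p r).inter convex_strip
  have hτm : Φ τ w ∈ Metric.ball p r ∩ strip := ⟨hmem τ hτ w h3, hΦ.mem_strip τ w⟩
  obtain ⟨z, hz, hmv⟩ := domain_mvt (fun x hx =>
    (hH.hasFDerivWithinAt hx.2).mono (inter_subset_right (s := Metric.ball p r)))
    hconv hτm ⟨h4, hw'⟩
  have hzm := hconv.segment_subset hτm ⟨h4, hw'⟩ hz
  have hzpos : 0 < fderivWithin ℝ (H ∘ cover) strip z v := hl z ▸ hball hzm
  rw [hc, map_smul, smul_eq_mul, Function.comp_apply, Function.comp_apply,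
    hΦ.hamiltonian_apply hH hw, hHw, sub_self, eq_comm, mul_eq_zero, or_iff_left hzpos.ne'] at hmv
  rw [hmv, zero_smul] at hc
  exact (sub_eq_zero.1 hc).symm

/-- Near a point where the vector field does not vanish, points on the same level of the
Hamiltonian are on the same trajectory. -/
theorem eventually_exists_apply_eq (hΦ : IsLiftedFlow φ Φ)
    (hH : IsHamiltonianIsotopy univ (fun _ => H) (fun t x => φ t x)) {p : ℝ × ℝ} (hp : p ∈ strip)
    (hX : hamVectorField H p ≠ 0) {ε : ℝ} (hε : 0 < ε) :
    ∀ᶠ q in 𝓝 (p, p), q.1 ∈ strip → q.2 ∈ strip → H (cover q.1) = H (cover q.2) →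
      ∃ τ, |τ| < ε ∧ Φ τ q.1 = q.2 := by
  have key : ∀ (l : ℝ × ℝ →L[ℝ] ℝ) (v : ℝ × ℝ), (∀ u, l u = 0 → ∃ c : ℝ, u = c • v) →
      (∀ z, l (hamVectorField H z) = fderivWithin ℝ (H ∘ cover) strip z v) →
      l (hamVectorField H p) ≠ 0 →
      ∀ᶠ q in 𝓝 (p, p), q.1 ∈ strip → q.2 ∈ strip → H (cover q.1) = H (cover q.2) →
        ∃ τ, |τ| < ε ∧ Φ τ q.1 = q.2 := by
    intro l v hker hl hne
    rcases lt_or_gt_of_ne hne with hneg | hpos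
    · refine hΦ.eventually_exists_apply_eq_of_pos hH hp (-l) (-v) (fun u hu => ?_)
        (fun z => by simp [hl]) (by simpa using hneg) hε
      obtain ⟨c, hc⟩ := hker u (by simpa using hu)
      exact ⟨-c, by simpa using hc⟩
    · exact hΦ.eventually_exists_apply_eq_of_pos hH hp l v hker hl hpos hε
  by_cases h1 : (hamVectorField H p).1 = 0
  · have h2 : (hamVectorField H p).2 ≠ 0 := fun h2 => hX (Prod.ext h1 h2)
    refine key (ContinuousLinearMap.snd ℝ ℝ ℝ) (-(1, 0)) (fun u hu => ⟨-u.1, ?_⟩)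
      (fun z => ?_) h2
    · exact Prod.ext (by simp) (by simpa using hu)
    · rw [map_neg]; rfl
  · refine key (ContinuousLinearMap.fst ℝ ℝ ℝ) (0, 1) (fun u hu => ⟨u.2, ?_⟩)
      (fun z => rfl) h1
    exact Prod.ext (by simpa using hu) (by simp)

end IsLiftedFlow

/-! ### The rotation number along the arc -/

open Classical in
/-- The rotation number of the trajectory of `(0, s)`: it is `1 / T` if the lifted trajectory is
translated by `(1, 0)` in time `T`, and `0` if there is no such `T`. -/
noncomputable def rotationNumber (Φ : ℝ → ℝ × ℝ → ℝ × ℝ) (s : ℝ) : ℝ :=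
  if h : ∃ T, Φ T (0, s) = (1, s) then 1 / h.choose else 0

namespace IsLiftedFlow

variable {H : Annulus → ℝ} {φ : Flow ℝ Annulus} {Φ : ℝ → ℝ × ℝ → ℝ × ℝ}

theorem eq_of_apply_eq_one (hΦ : IsLiftedFlow φ Φ) {s : ℝ} (hs : s ∈ Icc (0 : ℝ) 1) {T t u : ℝ}
    (hT : Φ T (0, s) = (1, s)) (h : Φ t (0, s) = Φ u (0, s)) : t = u :=
  hΦ.eq_of_apply_eq (mem_strip_iff.2 hs) (by simpa using hT) h

theorem rotationNumber_eq (hΦ : IsLiftedFlow φ Φ) {s : ℝ} (hs : s ∈ Icc (0 : ℝ) 1) {T : ℝ}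
    (hT : Φ T (0, s) = (1, s)) : rotationNumber Φ s = 1 / T := by
  have h : ∃ T, Φ T (0, s) = (1, s) := ⟨T, hT⟩
  rw [rotationNumber, dif_pos h, hΦ.eq_of_apply_eq_one hs hT (h.choose_spec.trans hT.symm)]

theorem ne_zero_of_apply_eq (hΦ : IsLiftedFlow φ Φ) {s : ℝ} (hs : s ∈ Icc (0 : ℝ) 1) {T : ℝ}
    (hT : Φ T (0, s) = (1, s)) : T ≠ 0 := by
  rintro rfl
  rw [hΦ.zero_apply _ (mem_strip_iff.2 hs)] at hT
  simp at hT

theorem exists_apply_eq_of_rotationNumber_ne_zero {s : ℝ} (h : rotationNumber Φ s ≠ 0) :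
    ∃ T, Φ T (0, s) = (1, s) := by
  by_contra h'
  exact h (dif_neg h')

theorem continuousOn_rotationNumber (hΦ : IsLiftedFlow φ Φ)
    (hH : IsHamiltonianIsotopy univ (fun _ => H) (fun t x => φ t x)) :
    ContinuousOn (rotationNumber Φ) (Icc 0 1) := by
  intro s₀ hs₀
  have hz : ((0 : ℝ), s₀) ∈ strip := mem_strip_iff.2 hs₀
  by_cases hex : ∃ T, Φ T (0, s₀) = (1, s₀)
  · obtain ⟨T₀, hT₀⟩ := hex
    have hT0 := hΦ.ne_zero_of_apply_eq hs₀ hT₀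
    have hX : hamVectorField H (0, s₀) ≠ 0 := fun h => by
      have := hΦ.apply_eq_self hH hz h T₀
      rw [hT₀] at this
      simp at this
    have htrans : ∀ s, Φ T₀ (0, s) - (1, 0) ∈ strip := fun s => by
      simpa [mem_strip_iff] using hΦ.mem_strip T₀ (0, s)
    have hq : ContinuousAt (fun s : ℝ => (((0 : ℝ), s), Φ T₀ (0, s) - (1, 0))) s₀ :=
      ((Continuous.prodMk_right _).prodMk
        (((hΦ.continuous_space T₀).comp (Continuous.prodMk_right _)).sub
          continuous_const)).continuousAt
    -- `Φ T₀ (0, s) - (1, 0)` is close to `(0, s₀)` and has the energy of `(0, s)`, so a short time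
    -- `τ` leads from `(0, s)` to it; the corrected time of a full turn is `T₀ - τ`.
    have hclose : ∀ ε > 0, ∀ᶠ s in 𝓝[Icc 0 1] s₀, ∃ T, |T - T₀| < ε ∧ Φ T (0, s) = (1, s) := by
      intro ε hε
      have h1 := hΦ.eventually_exists_apply_eq hH hz hX hε
      have h2 := hq.eventually (p := fun q => q.1 ∈ strip → q.2 ∈ strip →
        H (cover q.1) = H (cover q.2) → ∃ τ, |τ| < ε ∧ Φ τ q.1 = q.2) (by simpa [hT₀] using h1)
      filter_upwards [nhdsWithin_le_nhds h2, self_mem_nhdsWithin] with s h hs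
      have hzs : ((0 : ℝ), s) ∈ strip := mem_strip_iff.2 hs
      have hcov : cover (Φ T₀ (0, s) - (1, 0)) = cover (Φ T₀ (0, s)) := by
        have := cover_add_intCast (Φ T₀ (0, s) - (1, 0)) 1
        simpa using this.symm
      obtain ⟨τ, hτ, hτs⟩ := h hzs (htrans s)
        (by rw [hcov, hΦ.hamiltonian_apply hH hzs])
      refine ⟨T₀ - τ, by simpa using hτ, ?_⟩
      have h3 : Φ T₀ (0, s) = Φ τ ((0, s) + (((1 : ℤ) : ℝ), 0)) := by
        rw [hΦ.apply_add_intCast _ hzs, hτs]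
        simp
      rw [sub_eq_neg_add, hΦ.add_apply, h3, ← hΦ.add_apply, neg_add_cancel,
        hΦ.zero_apply _ (add_translation_mem_strip hzs _)]
      simp
    rw [ContinuousWithinAt, hΦ.rotationNumber_eq hs₀ hT₀, Metric.tendsto_nhds]
    intro ε hε
    obtain ⟨d, hd, hdε⟩ := Metric.continuousAt_iff.1
      ((continuousAt_const (y := (1 : ℝ))).div continuousAt_id hT0) ε hε
    filter_upwards [hclose d hd, self_mem_nhdsWithin] with s ⟨T, hT, hTs⟩ hs
    rw [hΦ.rotationNumber_eq hs hTs]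
    exact hdε hT
  · have hr0 : rotationNumber Φ s₀ = 0 := dif_neg hex
    rw [ContinuousWithinAt, hr0, Metric.tendsto_nhds]
    intro ε hε
    have hcont : Continuous fun q : ℝ × ℝ => Φ q.1 (0, q.2) :=
      hΦ.continuous.comp (continuous_fst.prodMk (continuous_const.prodMk continuous_snd))
    -- `ε ≤ |ρ s|` means a full-turn time in `[-1/ε, 1/ε]`. The heights admitting one form a compact
    -- set that misses `s₀`.
    have hcpt : IsCompact ((Icc (-(1 / ε)) (1 / ε) ×ˢ Icc (0 : ℝ) 1) ∩
        {q : ℝ × ℝ | Φ q.1 (0, q.2) = (1, q.2)}) :=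
      (isCompact_Icc.prod isCompact_Icc).inter_right
        (isClosed_eq hcont (continuous_const.prodMk continuous_snd))
    have hs₀K : s₀ ∈ (Prod.snd '' ((Icc (-(1 / ε)) (1 / ε) ×ˢ Icc (0 : ℝ) 1) ∩
        {q : ℝ × ℝ | Φ q.1 (0, q.2) = (1, q.2)}))ᶜ := by
      rintro ⟨⟨T, s⟩, ⟨-, hT⟩, rfl⟩
      exact hex ⟨T, hT⟩
    filter_upwards [nhdsWithin_le_nhds
      ((hcpt.image continuous_snd).isClosed.isOpen_compl.mem_nhds hs₀K), self_mem_nhdsWithin]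
      with s hsK hs
    rw [Real.dist_eq, sub_zero]
    by_contra! hle
    have hne : rotationNumber Φ s ≠ 0 := fun h => by simp [h] at hle; linarith
    obtain ⟨T, hT⟩ := exists_apply_eq_of_rotationNumber_ne_zero hne
    have hT0 := hΦ.ne_zero_of_apply_eq hs hT
    rw [hΦ.rotationNumber_eq hs hT, abs_div, abs_one] at hle
    have hTle : |T| ≤ 1 / ε := by
      rw [le_div_iff₀ hε]
      rw [le_div_iff₀ (abs_pos.2 hT0)] at hle
      linarith
    exact hsK ⟨(T, s), ⟨⟨abs_le.1 hTle, hs⟩, hT⟩, rfl⟩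

/-- On a boundary circle the displacement in time one is within `1` of the rotation number. -/
theorem abs_apply_sub_rotationNumber_le (hΦ : IsLiftedFlow φ Φ)
    (hH : IsHamiltonianIsotopy univ (fun _ => H) (fun t x => φ t x)) {s : ℝ}
    (hs : s = 0 ∨ s = 1) : |(Φ 1 (0, s)).1 - rotationNumber Φ s| ≤ 1 := by
  have hsI : s ∈ Icc (0 : ℝ) 1 := by rcases hs with rfl | rfl <;> simp
  have hz : ((0 : ℝ), s) ∈ strip := mem_strip_iff.2 hsI
  have hcont : Continuous fun t => (Φ t (0, s)).1 :=
    continuous_fst.comp (hΦ.continuous_time _)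
  have h0 : (Φ 0 (0, s)).1 = 0 := by rw [hΦ.zero_apply _ hz]
  have hpt : ∀ t, Φ t (0, s) = ((Φ t (0, s)).1, s) := fun t =>
    Prod.ext rfl (hΦ.apply_snd_of_boundary hH hs 0 t)
  by_cases hex : ∃ T, Φ T (0, s) = (1, s)
  · obtain ⟨T, hT⟩ := hex
    have hT0 := hΦ.ne_zero_of_apply_eq hsI hT
    have hinj : Function.Injective fun t => (Φ t (0, s)).1 := fun t u htu =>
      hΦ.eq_of_apply_eq_one hsI hT (by rw [hpt t, hpt u]; exact congrArg (·, s) htu)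
    have hmul : ∀ k : ℤ, (Φ (k * T) (0, s)).1 = k := fun k => by
      rw [hΦ.apply_intCast_mul hz (m := 1) (by simpa using hT)]
      simp
    have hone : (Φ T (0, s)).1 = 1 := by rw [hT]
    rw [hΦ.rotationNumber_eq hsI hT]
    set k := ⌊1 / T⌋
    have hk1 : (k : ℝ) ≤ 1 / T := Int.floor_le _
    have hk2 : 1 / T < k + 1 := Int.lt_floor_add_one _
    -- On the circle the first coordinate is injective in time, hence monotone or antitone according
    -- to the sign of `T`. It is `k` and `k + 1` at times `k * T` and `(k + 1) * T`, between which
    -- time `1` lies.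
    have key : (k : ℝ) ≤ (Φ 1 (0, s)).1 ∧ (Φ 1 (0, s)).1 ≤ k + 1 := by
      have hk' := hmul (k + 1)
      push_cast at hk'
      rw [← hk']
      nth_rewrite 1 [← hmul k]
      rcases hcont.strictMono_of_inj hinj with hm | hm
      · have hTpos : 0 < T := hm.lt_iff_lt.1 (by simp only [h0, hone]; exact one_pos)
        rw [le_div_iff₀ hTpos] at hk1
        rw [div_lt_iff₀ hTpos] at hk2
        exact ⟨hm.monotone hk1, hm.monotone hk2.le⟩
      · have hTneg : T < 0 := hm.lt_iff_gt.1 (by simp only [h0, hone]; exact one_pos)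
        rw [le_div_iff_of_neg hTneg] at hk1
        rw [div_lt_iff_of_neg hTneg] at hk2
        exact ⟨hm.antitone hk1, hm.antitone hk2.le⟩
    rw [abs_le]
    constructor <;> linarith [key.1, key.2]
  · have hr0 : rotationNumber Φ s = 0 := dif_neg hex
    rw [hr0, sub_zero]
    by_contra! hlt
    rcases lt_abs.1 hlt with h | h
    · obtain ⟨t, -, ht⟩ := intermediate_value_Icc zero_le_one hcont.continuousOn
        (show (1 : ℝ) ∈ _ from ⟨by linarith, h.le⟩)
      exact hex ⟨t, by rw [hpt t]; exact congrArg (·, s) ht⟩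
    · obtain ⟨t, -, ht⟩ := intermediate_value_Icc' zero_le_one hcont.continuousOn
        (show (-1 : ℝ) ∈ _ from ⟨by linarith, by linarith⟩)
      have h1 : Φ t (0, s) = (0, s) + (((-1 : ℤ) : ℝ), 0) := by
        rw [hpt t]; ext <;> simp; exact ht
      -- Reaching `-1` at time `t` means reaching `1` at time `-t`.
      have h2 := hΦ.apply_intCast_mul hz h1 (-1)
      exact hex ⟨_, h2.trans (by simp)⟩

/-- A point of the arc whose rotation number is a nonzero integer is on a loop of fixed points. -/
theorem exists_isLoopOfFixedPoints (hΦ : IsLiftedFlow φ Φ) {s : ℝ} (hs : s ∈ Icc (0 : ℝ) 1)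
    {n : ℤ} (hn : n ≠ 0) (h : rotationNumber Φ s = n) :
    ∃ c, IsLoopOfFixedPoints φ c ∧ (c ∩ arcL).Nonempty := by
  have hz : ((0 : ℝ), s) ∈ strip := mem_strip_iff.2 hs
  obtain ⟨T, hT⟩ := exists_apply_eq_of_rotationNumber_ne_zero (Φ := Φ) (s := s)
    (by rw [h]; exact_mod_cast hn)
  have hTn : 1 / T = n := by rw [← hΦ.rotationNumber_eq hs hT, h]
  have hT0 := hΦ.ne_zero_of_apply_eq hs hT
  set x := cover (0, s) with hx
  have hTx : φ T x = x := by
    rw [hx, ← hΦ.cover_apply, hT]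
    simpa using cover_add_intCast (0, s) 1
  -- The return times form a closed subgroup of `ℝ`, not dense because `x` moves, hence cyclic; its
  -- positive generator is the minimal period. With `T = k * |a|` one gets `1 / |a| = n * k`, an
  -- integer that is positive even when `T` is negative.
  let S : AddSubgroup ℝ :=
    { carrier := {t | φ t x = x}
      zero_mem' := φ.map_zero_apply x
      add_mem' := fun {a b} ha hb => by
        simp only [mem_ofPred_eq] at ha hb ⊢
        rw [φ.map_add, hb, ha]
      neg_mem' := fun {a} ha => by
        simp only [mem_ofPred_eq] at ha ⊢
        nth_rewrite 1 [← ha]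
        rw [← φ.map_add, neg_add_cancel, φ.map_zero_apply] }
  have hTS : T ∈ S := hTx
  have hclosed : IsClosed (S : Set ℝ) :=
    isClosed_eq (φ.continuous continuous_id continuous_const) continuous_const
  obtain ⟨a, ha⟩ : ∃ a, S = AddSubgroup.closure {a} := by
    refine S.dense_or_cyclic.resolve_left fun hd => ?_
    have huniv : (S : Set ℝ) = univ := by rw [← hclosed.closure_eq, hd.closure_eq]
    have hfix : ∀ t, φ t x = x := fun t => (huniv ▸ mem_univ t : t ∈ (S : Set ℝ))
    have hconst := hΦ.eq_of_cover_eq hz (γ := fun _ => (0, s)) continuous_const (fun _ => hz)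
      (fun t => (hfix t).symm) rfl
    have := congrFun hconst T
    rw [hT] at this
    simp at this
  rw [← AddSubgroup.zmultiples_eq_closure] at ha
  have habs : S = AddSubgroup.zmultiples |a| := by
    rcases abs_choice a with h | h
    · rw [h, ha]
    · rw [h, ha, AddSubgroup.zmultiples_neg]
  obtain ⟨k, hk⟩ := AddSubgroup.mem_zmultiples_iff.1 (habs ▸ hTS)
  have hapos : 0 < |a| := by
    refine lt_of_le_of_ne (abs_nonneg a) fun h => hT0 ?_
    rw [← hk, ← h, smul_zero]
  refine ⟨φ.orbit x, ⟨x, |a|, rfl, ⟨⟨hapos, ?_⟩, ?_⟩, (n * k).natAbs, ?_⟩,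
    x, φ.mem_orbit_self x, ?_⟩
  · exact (habs ▸ AddSubgroup.mem_zmultiples |a| : |a| ∈ S)
  · rintro t ⟨ht, htx⟩
    obtain ⟨m, rfl⟩ := AddSubgroup.mem_zmultiples_iff.1 (habs ▸ (show t ∈ S from htx))
    have hm : 0 < m := by
      rw [zsmul_eq_mul] at ht
      exact_mod_cast pos_of_mul_pos_left ht hapos.le
    have hm1 : (1 : ℝ) ≤ m := by exact_mod_cast hm
    rw [zsmul_eq_mul]
    nlinarith
  · have h1 : (n : ℝ) * k * |a| = 1 := by
      rw [mul_assoc, ← zsmul_eq_mul |a| k, hk, ← hTn, one_div_mul_cancel hT0]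
    have h2 : 0 < (n : ℝ) * k := pos_of_mul_pos_left (h1 ▸ one_pos) hapos.le
    rw [Nat.cast_natAbs, Int.cast_abs, Int.cast_mul, abs_of_pos h2]
    exact (eq_div_of_mul_eq hapos.ne' h1).symm
  · simp [arcL, hx, cover]

/-- Two lifts of the time-one map differ by a constant along the arc. -/
theorem lift_sub_eq (hΦ : IsLiftedFlow φ Φ) {G : ℝ × ℝ → ℝ × ℝ} {g : Annulus → Annulus}
    (hG : IsLift G g) (hg : ∀ x, φ 1 x = g x) :
    (G (0, 1)).1 - (G (0, 0)).1 = (Φ 1 (0, 1)).1 - (Φ 1 (0, 0)).1 := by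
  have hmem : ∀ s : unitInterval, ((0 : ℝ), (s : ℝ)) ∈ strip := fun s => mem_strip_iff.2 s.2
  have hcover : ∀ s : unitInterval, cover (G (0, s)) = cover (Φ 1 (0, s)) := fun s => by
    rw [hG.cover_comp _ (hmem s), hΦ.cover_apply, hg]
  obtain ⟨n, hn⟩ : ∃ n : ℤ, (n : ℝ) = (G (0, 0)).1 - (Φ 1 (0, 0)).1 := by
    have h := congrArg Prod.fst (hcover 0)
    simp only [cover, Icc.coe_zero] at h
    rw [← sub_eq_zero, ← AddCircle.coe_sub, AddCircle.coe_eq_zero_iff] at h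
    simpa using h
  have hinc : Continuous fun s : unitInterval => ((0 : ℝ), (s : ℝ)) :=
    continuous_const.prodMk continuous_subtype_val
  have key := lift_unique (X := unitInterval) (f := fun s => G (0, s))
    (g := fun s => Φ 1 (0, s) + ((n : ℝ), 0)) (hG.continuousOn.comp_continuous hinc hmem)
    (((hΦ.continuous_space 1).comp hinc).add continuous_const) (fun s => hG.mapsTo (hmem s))
    (fun s => add_translation_mem_strip (hΦ.mem_strip _ _) _)
    (fun s => by rw [hcover, cover_add_intCast]) 0 (by simp [hn])
  have h1 := congrArg Prod.fst (congrFun key 1)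
  simp only [Icc.coe_one, Prod.fst_add] at h1
  linarith

end IsLiftedFlow

end AnnulusFlow

theorem mainTheorem3 :
    AnnulusFlow.FixedLoopProperty AnnulusFlow.arcL AnnulusFlow.twistFamily := by
  rintro g ⟨-, G, hG, hGtwist⟩ φ ⟨H, hH⟩ hg
  obtain ⟨Φ, hΦ⟩ := AnnulusFlow.exists_isLiftedFlow φ
  rw [hΦ.lift_sub_eq hG hg] at hGtwist
  have h0 := abs_le.1 (hΦ.abs_apply_sub_rotationNumber_le hH (Or.inl rfl))
  have h1 := abs_le.1 (hΦ.abs_apply_sub_rotationNumber_le hH (Or.inr rfl))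
  set ρ := AnnulusFlow.rotationNumber Φ
  -- As `ρ 1 - ρ 0 > 4 - 1 - 1 = 2`, both `⌊ρ 0⌋ + 1` and `⌊ρ 0⌋ + 2` lie in the interval, and at
  -- most one of them is zero.
  obtain ⟨n, hn, hn0, hn1⟩ : ∃ n : ℤ, n ≠ 0 ∧ ρ 0 ≤ n ∧ (n : ℝ) ≤ ρ 1 := by
    have hf1 := Int.lt_floor_add_one (ρ 0)
    have hf2 := Int.floor_le (ρ 0)
    by_cases hf : ⌊ρ 0⌋ + 1 = 0
    · exact ⟨⌊ρ 0⌋ + 2, by omega, by push_cast; linarith, by push_cast; linarith [h0.1, h1.2]⟩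
    · exact ⟨⌊ρ 0⌋ + 1, hf, by push_cast; linarith, by push_cast; linarith [h0.1, h1.2]⟩
  obtain ⟨s, hs, hsn⟩ := intermediate_value_Icc zero_le_one (hΦ.continuousOn_rotationNumber hH)
    ⟨hn0, hn1⟩
  exact hΦ.exists_isLoopOfFixedPoints hs hn hsn
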